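/- Call a function $f:I\to\mathbf{R}$ on an interval $I\subseteq\mathbf{R}$ *completely monotone* on $I$ if it has derivatives of all orders and $(-1)^n f^{(n)}(x)\ge 0$ for all $n=0,1,2,\ldots$ and all $x\in I$. Let $\psi=\Gamma'/\Gamma$ be the digamma function. Let $a,b\ge 0$ and $\alpha,\beta$ be real numbers, and put $$f_{\alpha,\beta}(x)=(x+a)^{\alpha}\left[\psi(x+b)-\psi(x+a)-\frac{\beta}{x+a}\right],\qquad x>\max(-a,-b).$$ (i) If $b=a$, then $f_{\alpha,\beta}$ is completely monotone on $(-a,\infty)$ if and only if either $\beta=0$ ($\alpha$ arbitrary), or $\beta<0$ and $\alpha\le 1$. (ii) If $b=a+1$, then $f_{\alpha,\beta}$ is completely monotone on $(-a,\infty)$ if and only if either $\beta=1$ ($\alpha$ arbitrary), or $\beta<1$ and $\alpha\le 1$. (iii) Let $0<1-b+a<1$ (that is, $a<b<a+1$) and $\beta\le b-a$. (iii$_1$) If $\alpha\le 1$, then $f_{\alpha,\beta}$ is completely monotone on $(-a,\infty)$. The bounds $a<b$ and $b<a+1$ are sharp: if $b<a$ or $b>a+1$ (with $b\ge 0$), then,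 for every real $\alpha$, the function $f_{\alpha,b-a}$ is not completely monotone on $(\max(-a,-b),\infty)$. The upper bound for $\beta$ is sharp: if $a<b<a+1$ and $\beta>b-a$, then, for every real $\alpha$, the function $f_{\alpha,\beta}$ is not completely monotone on $(-a,\infty)$. (iii$_2$) If $f_{\alpha,\beta}$ is completely monotone on $(-a,\infty)$, then $\alpha\le 1$ when $\beta<b-a$, and $\alpha\le 2$ when $\beta=b-a$. -/

import Mathlib

open Set
open scoped ContDiff

/-- A real function `f` is completely monotone on the interval `I` if it has derivatives of all
orders there and `(-1)^n f^(n)(x) ≥ 0` for all `n = 0, 1, 2, …` and all `x ∈ I`. -/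
def CompletelyMonotoneOn (f : ℝ → ℝ) (I : Set ℝ) : Prop :=
  ContDiffOn ℝ ∞ f I ∧ ∀ n : ℕ, ∀ x ∈ I, 0 ≤ (-1 : ℝ) ^ n * iteratedDerivWithin n f I x

/-- The digamma function `ψ = Γ' / Γ` of a real variable. -/
noncomputable def realDigamma (x : ℝ) : ℝ := deriv Real.Gamma x / Real.Gamma x

/-- On the positive half-line, `realDigamma` is the restriction of the complex digamma function. -/
theorem ofReal_realDigamma {x : ℝ} (hx : 0 < x) :
    ((realDigamma x : ℝ) : ℂ) = Complex.digamma (x : ℂ) := by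
  have hne : ∀ m : ℕ, (x : ℂ) ≠ -m := by
    intro m h
    have h' : x = -(m : ℝ) := by exact_mod_cast h
    have : (0 : ℝ) ≤ m := m.cast_nonneg
    linarith
  have h1 := (Complex.differentiableAt_Gamma (x : ℂ) hne).hasDerivAt
  have h2 : HasDerivAt (fun y : ℝ => ((Real.Gamma y : ℝ) : ℂ))
      (deriv Complex.Gamma (x : ℂ)) x := by
    simpa only [Complex.Gamma_ofReal] using h1.comp_ofReal
  have hne' : ∀ m : ℕ, x ≠ -m := fun m h => hne m (by exact_mod_cast h)
  have h3 : HasDerivAt (fun y : ℝ => ((Real.Gamma y : ℝ) : ℂ)) ((deriv Real.Gamma x : ℝ) : ℂ) x :=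
    (Real.differentiableAt_Gamma hne').hasDerivAt.ofReal_comp
  rw [Complex.digamma_def, logDeriv_apply, ← h3.unique h2, Complex.Gamma_ofReal, realDigamma,
    Complex.ofReal_div]

/-- The function `x ↦ (x + a)^α [ψ(x + b) - ψ(x + a) - β / (x + a)]`,
considered for `x > max (-a) (-b)`. -/
noncomputable def digammaDiff (a b α β : ℝ) (x : ℝ) : ℝ :=
  (x + a) ^ α * (realDigamma (x + b) - realDigamma (x + a) - β / (x + a))

/-!
Put `u = x + a` and `c = b - a`. On the domain,
`f(x) = u^(α - 1) (u (ψ(u + c) - ψ(u)) - β) = u^(α - 1) (u E(u) + c - β)`, where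
`E(u) = ψ(u + c) - ψ(u) - c / u` is `digammaDefect c u`.

Signs are read off from differences with step one: a function vanishing at infinity whose step-one
differences have a fixed sign has a sign itself (`nonneg_of_add_one_le_of_tendsto_zero`). The
functional equation of `ψ` gives `E(u) - E(u + 1) = c (1 - c) / (u (u + 1) (u + c))`, and `E`
vanishes at infinity because log-convexity of `Γ` gives `log x - 1 / x ≤ ψ(x) ≤ log x`. Hence
`E < 0` when `c` lies outside `[0, 1]` (`digammaDefect_neg`), and for `0 < c < 1` the function `E`
lies between `c (1 - c) / (2 u (u + 1))` and `c (1 - c) / (u (u + c))` (`le_digammaDefect`,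
`digammaDefect_le`). All the necessary conditions follow: a completely monotone function is nonnegative
and cannot tend to infinity. For `c = 0` and `c = 1` the function `E` vanishes and `f` is a multiple of a power.

For sufficiency, `u^(α - 1)` is completely monotone when `α ≤ 1`, and products preserve complete
monotonicity, so the point is that `u (ψ(u + c) - ψ(u)) - β` is completely monotone for `0 < c < 1`
and `β ≤ c`. With `S_n` (`polygammaDiff c n`) the signed derivatives of
`ψ(u + c) - ψ(u) = ∑ (1 / (u + k) - 1 / (u + k + c))`, this means `u S_{n+1}(u) ≥ (n + 1) S_n(u)`
together with `E ≥ 0`, the condition of order zero. The second step-one difference of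
`u S_{n+1}(u) - (n + 1) S_n(u)` is `c r(u + c) + (1 - c) r(u + 1 + c) - r(u + 1)` with
`r(x) = (n + 1)! / x^(n + 2)`, which is nonnegative since `r` is convex and `c (u + c) + (1 - c) (u + 1 + c) = u + 1`
(`mul_polygammaDiff_succ_sub_nonneg`).
-/

open Filter Topology

/-! ### Completely monotone functions -/

/-- Complete monotonicity from an explicit list `F n = (-1)^n F^(n)` of signed derivatives, given on
the positive half-line and translated to `(-a, ∞)`. -/
theorem completelyMonotoneOn_comp_add_of_hasDerivAt (a : ℝ) (F : ℕ → ℝ → ℝ)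
    (hF : ∀ n, ∀ u > 0, HasDerivAt (F n) (-(F (n + 1) u)) u) (hpos : ∀ n, ∀ u > 0, 0 ≤ F n u) :
    CompletelyMonotoneOn (fun x => F 0 (x + a)) (Ioi (-a)) := by
  have hder : ∀ n, ∀ x ∈ Ioi (-a),
      HasDerivAt (fun x => (-1 : ℝ) ^ n * F n (x + a)) ((-1) ^ (n + 1) * F (n + 1) (x + a)) x := by
    intro n x hx
    have hx' : 0 < x + a := by rw [mem_Ioi] at hx; linarith
    have := ((hF n _ hx').comp_add_const x a).const_mul ((-1 : ℝ) ^ n)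
    exact this.congr_deriv (by ring)
  have hiter : ∀ n, EqOn (iteratedDerivWithin n (fun x => F 0 (x + a)) (Ioi (-a)))
      (fun x => (-1 : ℝ) ^ n * F n (x + a)) (Ioi (-a)) := by
    intro n
    induction n with
    | zero => intro x _; simp
    | succ n ih =>
      intro x hx
      rw [iteratedDerivWithin_succ, derivWithin_congr ih (ih hx),
        (hder n x hx).hasDerivWithinAt.derivWithin (uniqueDiffOn_Ioi _ x hx)]
  refine ⟨contDiffOn_of_differentiableOn_deriv (n := ⊤) fun m _ => ?_, fun n x hx => ?_⟩
  · exact DifferentiableOn.congr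
      (fun x hx => (hder m x hx).differentiableAt.differentiableWithinAt) (hiter m)
  · rw [hiter n hx, ← mul_assoc, ← mul_pow]
    rw [mem_Ioi] at hx
    simpa using hpos n (x + a) (by linarith)

namespace CompletelyMonotoneOn

theorem congr {f g : ℝ → ℝ} {I : Set ℝ} (hf : CompletelyMonotoneOn f I) (h : EqOn g f I) :
    CompletelyMonotoneOn g I :=
  ⟨hf.1.congr h, fun n x hx => by rw [iteratedDerivWithin_congr h hx]; exact hf.2 n x hx⟩

/-- Products of completely monotone functions are completely monotone, by the Leibniz rule. -/
theorem mul {f g : ℝ → ℝ} {I : Set ℝ} (hI : UniqueDiffOn ℝ I) (hf : CompletelyMonotoneOn f I)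
    (hg : CompletelyMonotoneOn g I) : CompletelyMonotoneOn (f * g) I := by
  refine ⟨hf.1.mul hg.1, fun n x hx => ?_⟩
  have := iteratedDerivWithin_mul (n := n) hx hI
    ((hf.1 x hx).of_le (by exact_mod_cast le_top)) ((hg.1 x hx).of_le (by exact_mod_cast le_top))
  rw [this, Finset.mul_sum]
  refine Finset.sum_nonneg fun i hi => ?_
  have hi' : i ≤ n := by simpa [Nat.lt_succ_iff] using hi
  have h := mul_nonneg (mul_nonneg (hf.2 i x hx) (hg.2 (n - i) x hx)) (Nat.cast_nonneg (n.choose i))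
  have hpow : (-1 : ℝ) ^ n = (-1) ^ i * (-1) ^ (n - i) := by rw [← pow_add, Nat.add_sub_cancel' hi']
  rw [hpow]
  convert h using 1
  ring

theorem nonneg {f : ℝ → ℝ} {I : Set ℝ} (hf : CompletelyMonotoneOn f I) {x : ℝ} (hx : x ∈ I) :
    0 ≤ f x := by
  simpa using hf.2 0 x hx

theorem antitoneOn_Ioi {f : ℝ → ℝ} {m : ℝ} (hf : CompletelyMonotoneOn f (Ioi m)) :
    AntitoneOn f (Ioi m) := by
  have hd : DifferentiableOn ℝ f (Ioi m) := hf.1.differentiableOn (by simp)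
  refine antitoneOn_of_deriv_nonpos (convex_Ioi m) hd.continuousOn
    (hd.mono interior_subset) fun x hx => ?_
  rw [interior_Ioi] at hx
  have := hf.2 1 x hx
  rw [iteratedDerivWithin_one, derivWithin_of_isOpen isOpen_Ioi hx] at this
  linarith

theorem not_tendsto_atTop {f : ℝ → ℝ} {m : ℝ} (hf : CompletelyMonotoneOn f (Ioi m)) :
    ¬ Tendsto f atTop atTop := by
  intro h
  obtain ⟨x, hx, hx'⟩ := ((h.eventually_gt_atTop (f (m + 1))).and
    (eventually_ge_atTop (m + 1))).exists
  exact absurd (hf.antitoneOn_Ioi (mem_Ioi.2 (by linarith : m < m + 1))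
    (mem_Ioi.2 (by linarith : m < x)) hx') (not_le.2 hx)

end CompletelyMonotoneOn

theorem completelyMonotoneOn_const_mul_rpow (a : ℝ) {C s : ℝ} (hC : 0 ≤ C) (hs : s ≤ 0) :
    CompletelyMonotoneOn (fun x => C * (x + a) ^ s) (Ioi (-a)) := by
  let F : ℕ → ℝ → ℝ := fun n u => C * (∏ i ∈ Finset.range n, (i - s)) * u ^ (s - n)
  have h := completelyMonotoneOn_comp_add_of_hasDerivAt a F (fun n u hu => ?_) (fun n u hu => ?_)
  · simpa [F] using h
  · have := (Real.hasDerivAt_rpow_const (p := s - n) (Or.inl hu.ne')).const_mul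
      (C * (∏ i ∈ Finset.range n, ((i : ℝ) - s)))
    refine this.congr_deriv ?_
    simp only [F, Finset.prod_range_succ, Nat.cast_succ, sub_sub]
    ring
  · refine mul_nonneg (mul_nonneg hC (Finset.prod_nonneg fun i _ => ?_)) (Real.rpow_nonneg hu.le _)
    have : (0 : ℝ) ≤ i := i.cast_nonneg
    linarith

theorem completelyMonotoneOn_const_mul_rpow_iff (a C s : ℝ) :
    CompletelyMonotoneOn (fun x => C * (x + a) ^ s) (Ioi (-a)) ↔ C = 0 ∨ (0 < C ∧ s ≤ 0) := by
  constructor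
  · intro h
    have h1 : 0 ≤ C := by simpa using h.nonneg (x := 1 - a) (by simp)
    rcases h1.eq_or_lt with h0 | h0
    · exact Or.inl h0.symm
    refine Or.inr ⟨h0, not_lt.1 fun hs => h.not_tendsto_atTop ?_⟩
    exact ((tendsto_rpow_atTop hs).comp
      (tendsto_atTop_add_const_right _ a tendsto_id)).const_mul_atTop h0
  · rintro (rfl | ⟨hC, hs⟩)
    · simpa using completelyMonotoneOn_const_mul_rpow a le_rfl le_rfl (s := 0)
    · exact completelyMonotoneOn_const_mul_rpow a hC.le hs

/-! ### Differences with step one -/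

/-- A function tending to zero at infinity is nonnegative if it decreases along steps of length one.
This turns a functional equation relating `F u` and `F (u + 1)` into a sign for `F`. -/
theorem nonneg_of_add_one_le_of_tendsto_zero {F : ℝ → ℝ} {m : ℝ} (h : ∀ u > m, F (u + 1) ≤ F u)
    (hF : Tendsto F atTop (𝓝 0)) {u : ℝ} (hu : m < u) : 0 ≤ F u := by
  have hanti : Antitone fun k : ℕ => F (u + k) := by
    refine antitone_nat_of_succ_le fun k => ?_
    have := h (u + k) (by have : (0 : ℝ) ≤ k := k.cast_nonneg
                          linarith)
    rwa [add_assoc, ← Nat.cast_succ] at this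
  have hlim : Tendsto (fun k : ℕ => F (u + k)) atTop (𝓝 0) :=
    hF.comp (tendsto_atTop_add_const_left _ u tendsto_natCast_atTop_atTop)
  simpa using hanti.le_of_tendsto hlim 0

/-! ### The digamma function at infinity -/

theorem realDigamma_add_one {x : ℝ} (hx : 0 < x) :
    realDigamma (x + 1) = realDigamma x + 1 / x := by
  have h := Complex.digamma_apply_add_one (x : ℂ) fun m h => by
    have h' : x = -(m : ℝ) := by exact_mod_cast h
    have : (0 : ℝ) ≤ m := m.cast_nonneg
    linarith
  rw [← ofReal_realDigamma hx, ← Complex.ofReal_one, ← Complex.ofReal_add,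
    ← ofReal_realDigamma (by positivity)] at h
  rw [one_div]
  exact_mod_cast h

/-- The tangent of the convex function `log Γ` at `x` lies below its chord over `[x, x + 1]`. -/
theorem realDigamma_le_log {x : ℝ} (hx : 0 < x) : realDigamma x ≤ Real.log x := by
  have hd : HasDerivAt (Real.log ∘ Real.Gamma) (realDigamma x) x :=
    (Real.differentiableAt_Gamma fun m => ne_of_gt (by
      have : (0 : ℝ) ≤ m := m.cast_nonneg
      linarith)).hasDerivAt.log (Real.Gamma_pos_of_pos hx).ne'
  have h := Real.convexOn_log_Gamma.le_slope_of_hasDerivAt (mem_Ioi.2 hx)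
    (mem_Ioi.2 (by positivity : 0 < x + 1)) (by linarith) hd
  rw [slope_def_field, Function.comp_apply, Function.comp_apply, Real.Gamma_add_one hx.ne',
    Real.log_mul hx.ne' (Real.Gamma_pos_of_pos hx).ne'] at h
  simpa using h

theorem log_sub_one_div_le_realDigamma {x : ℝ} (hx : 0 < x) :
    Real.log x - 1 / x ≤ realDigamma x := by
  have hx1 : 0 < x + 1 := by positivity
  have hd : HasDerivAt (Real.log ∘ Real.Gamma) (realDigamma (x + 1)) (x + 1) :=
    (Real.differentiableAt_Gamma fun m => ne_of_gt (by
      have : (0 : ℝ) ≤ m := m.cast_nonneg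
      linarith)).hasDerivAt.log (Real.Gamma_pos_of_pos hx1).ne'
  have h := Real.convexOn_log_Gamma.slope_le_of_hasDerivAt (mem_Ioi.2 hx)
    (mem_Ioi.2 hx1) (by linarith) hd
  rw [slope_def_field, Function.comp_apply, Function.comp_apply, Real.Gamma_add_one hx.ne',
    Real.log_mul hx.ne' (Real.Gamma_pos_of_pos hx).ne', realDigamma_add_one hx] at h
  simp only [add_sub_cancel_right, add_sub_cancel_left, div_one] at h
  linarith

theorem tendsto_realDigamma_sub_log :
    Tendsto (fun x => realDigamma x - Real.log x) atTop (𝓝 0) := by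
  have h : Tendsto (fun x : ℝ => -(1 / x)) atTop (𝓝 0) := by
    simpa using (tendsto_inv_atTop_zero (𝕜 := ℝ)).neg
  refine tendsto_of_tendsto_of_tendsto_of_le_of_le' h tendsto_const_nhds ?_ ?_
  · filter_upwards [eventually_gt_atTop 0] with x hx
    linarith [log_sub_one_div_le_realDigamma hx]
  · filter_upwards [eventually_gt_atTop 0] with x hx
    linarith [realDigamma_le_log hx]

theorem tendsto_realDigamma_add_sub (c : ℝ) :
    Tendsto (fun u => realDigamma (u + c) - realDigamma u) atTop (𝓝 0) := by
  have h := ((tendsto_realDigamma_sub_log.comp (tendsto_atTop_add_const_right _ c tendsto_id)).sub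
    tendsto_realDigamma_sub_log).add (Real.tendsto_log_comp_add_sub_log c)
  simp only [sub_zero, add_zero] at h
  refine h.congr fun u => ?_
  simp only [Function.comp_apply, id]
  ring

/-! ### The defect of the first-order approximation -/

/-- The error `ψ(u + c) - ψ(u) - c / u` of the leading term of a difference of digamma values. -/
noncomputable def digammaDefect (c u : ℝ) : ℝ := realDigamma (u + c) - realDigamma u - c / u

theorem tendsto_digammaDefect (c : ℝ) : Tendsto (digammaDefect c) atTop (𝓝 0) := by
  have h : Tendsto (fun u : ℝ => c / u) atTop (𝓝 0) := tendsto_const_nhds.div_atTop tendsto_id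
  rw [← sub_zero (0 : ℝ)]
  exact (tendsto_realDigamma_add_sub c).sub h

theorem digammaDefect_sub_add_one {c u : ℝ} (hu : 0 < u) (huc : 0 < u + c) :
    digammaDefect c u - digammaDefect c (u + 1) = c * (1 - c) / (u * (u + 1) * (u + c)) := by
  have hu1 : u + 1 ≠ 0 := by positivity
  have hu0 := hu.ne'
  have huc0 := huc.ne'
  rw [digammaDefect, digammaDefect, add_right_comm, realDigamma_add_one hu, realDigamma_add_one huc]
  field_simp
  ring

theorem digammaDefect_neg {c u : ℝ} (hc : c * (1 - c) < 0) (hu : 0 < u) (huc : 0 < u + c) :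
    digammaDefect c u < 0 := by
  have hstep : ∀ v > max 0 (-c), digammaDefect c v < digammaDefect c (v + 1) := by
    intro v hv
    obtain ⟨hv0, hvc⟩ := max_lt_iff.1 hv
    have hvc' : 0 < v + c := by linarith
    have : c * (1 - c) / (v * (v + 1) * (v + c)) < 0 := div_neg_of_neg_of_pos hc (by positivity)
    linarith [digammaDefect_sub_add_one hv0 hvc']
  have h := nonneg_of_add_one_le_of_tendsto_zero (F := fun v => -digammaDefect c v)
    (fun v hv => neg_le_neg (hstep v hv).le) (by simpa using (tendsto_digammaDefect c).neg)
    (u := u + 1) (max_lt (by linarith) (by linarith))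
  linarith [hstep u (max_lt hu (by linarith))]

/-- Comparison with `c (1 - c) / (2 u (u + 1))`, whose step-one difference is smaller. -/
theorem le_digammaDefect {c u : ℝ} (h0 : 0 < c) (h1 : c < 1) (hu : 0 < u) :
    c * (1 - c) / (2 * (u * (u + 1))) ≤ digammaDefect c u := by
  have hc : 0 < c * (1 - c) := mul_pos h0 (by linarith)
  have h := nonneg_of_add_one_le_of_tendsto_zero (m := 0)
    (F := fun v => digammaDefect c v - c * (1 - c) / (2 * (v * (v + 1)))) ?_ ?_ hu
  · linarith
  · intro v hv
    have hv : 0 < v := hv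
    have e1 := digammaDefect_sub_add_one hv (by positivity : 0 < v + c)
    have e2 : c * (1 - c) / (2 * (v * (v + 1))) - c * (1 - c) / (2 * ((v + 1) * (v + 1 + 1)))
        = c * (1 - c) / (v * (v + 1) * (v + 2)) := by
      field_simp
      ring
    have e3 : c * (1 - c) / (v * (v + 1) * (v + 2)) ≤ c * (1 - c) / (v * (v + 1) * (v + c)) := by
      gcongr
      linarith
    linarith
  · have hinf : Tendsto (fun v : ℝ => 2 * (v * (v + 1))) atTop atTop :=
      (tendsto_id.atTop_mul_atTop₀ (tendsto_atTop_add_const_right _ 1 tendsto_id)).const_mul_atTop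
        two_pos
    simpa using (tendsto_digammaDefect c).sub
      ((tendsto_const_nhds (x := c * (1 - c))).div_atTop hinf)

/-- Comparison with `c (1 - c) / (u (u + c))`, whose step-one difference is larger. -/
theorem digammaDefect_le {c u : ℝ} (h0 : 0 < c) (h1 : c < 1) (hu : 0 < u) :
    digammaDefect c u ≤ c * (1 - c) / (u * (u + c)) := by
  have hc : 0 < c * (1 - c) := mul_pos h0 (by linarith)
  have h := nonneg_of_add_one_le_of_tendsto_zero (m := 0)
    (F := fun v => c * (1 - c) / (v * (v + c)) - digammaDefect c v) ?_ ?_ hu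
  · linarith
  · intro v hv
    have hv : 0 < v := hv
    have e1 := digammaDefect_sub_add_one hv (by positivity : 0 < v + c)
    have e2 : c * (1 - c) / (v * (v + c)) - c * (1 - c) / ((v + 1) * (v + 1 + c))
        - c * (1 - c) / (v * (v + 1) * (v + c))
        = c * (1 - c) / ((v + 1) * (v + c) * (v + 1 + c)) := by
      field_simp
      ring
    have e3 : 0 ≤ c * (1 - c) / ((v + 1) * (v + c) * (v + 1 + c)) := by positivity
    linarith
  · have hinf : Tendsto (fun v : ℝ => v * (v + c)) atTop atTop :=
      tendsto_id.atTop_mul_atTop₀ (tendsto_atTop_add_const_right _ c tendsto_id)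
    simpa using ((tendsto_const_nhds (x := c * (1 - c))).div_atTop hinf).sub
      (tendsto_digammaDefect c)

/-! ### Differences of polygamma functions -/

/-- The signed `n`-th derivative `n! / x^(n+1)` of `1 / x`. -/
noncomputable def invDeriv (n : ℕ) (x : ℝ) : ℝ := n.factorial / x ^ (n + 1)

theorem invDeriv_le_invDeriv (n : ℕ) {x y : ℝ} (hx : 0 < x) (hxy : x ≤ y) :
    invDeriv n y ≤ invDeriv n x := by
  unfold invDeriv; gcongr

theorem mul_invDeriv_succ (n : ℕ) {x : ℝ} (hx : 0 < x) :
    x * invDeriv (n + 1) x = (n + 1) * invDeriv n x := by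
  simp only [invDeriv, Nat.factorial_succ]
  push_cast
  field_simp
  ring

theorem hasDerivAt_invDeriv (n : ℕ) {x : ℝ} (hx : 0 < x) :
    HasDerivAt (invDeriv n) (-invDeriv (n + 1) x) x := by
  have h := ((hasDerivAt_pow (n + 1) x).fun_inv (by positivity)).const_mul (n.factorial : ℝ)
  refine h.congr_deriv ?_
  simp only [invDeriv, Nat.factorial_succ]
  push_cast
  field_simp
  ring

theorem tendsto_invDeriv (n : ℕ) : Tendsto (invDeriv n) atTop (𝓝 0) :=
  tendsto_const_nhds.div_atTop (tendsto_pow_atTop n.succ_ne_zero)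

theorem convexOn_invDeriv (n : ℕ) : ConvexOn ℝ (Ioi 0) (invDeriv n) := by
  refine ((convexOn_zpow (-(n + 1 : ℕ) : ℤ)).smul (Nat.cast_nonneg n.factorial)).congr
    fun x _ => ?_
  simp only [smul_eq_mul]
  rw [zpow_neg, zpow_natCast, invDeriv, div_eq_mul_inv]

/-- The signed `n`-th derivative of the series `∑ (1 / (u + k) - 1 / (u + k + c))`, which represents
`ψ(u + c) - ψ(u)`. It is used for `0 ≤ c ≤ 1` and `u > 0`, where the series converges. -/
noncomputable def polygammaDiff (c : ℝ) (n : ℕ) (u : ℝ) : ℝ :=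
  ∑' k : ℕ, (invDeriv n (u + k) - invDeriv n (u + k + c))

theorem hasDerivAt_invDeriv_sub {c : ℝ} (hc : 0 ≤ c) (n : ℕ) {x : ℝ} (hx : 0 < x) :
    HasDerivAt (fun x => invDeriv n x - invDeriv n (x + c))
      (-(invDeriv (n + 1) x - invDeriv (n + 1) (x + c))) x :=
  ((hasDerivAt_invDeriv n hx).sub
    ((hasDerivAt_invDeriv n (by positivity : 0 < x + c)).comp_add_const x c)).congr_deriv (by ring)

theorem invDeriv_sub_nonneg {c : ℝ} (hc : 0 ≤ c) (n : ℕ) {x : ℝ} (hx : 0 < x) :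
    0 ≤ invDeriv n x - invDeriv n (x + c) :=
  sub_nonneg.2 (invDeriv_le_invDeriv n hx (by linarith))

theorem antitoneOn_invDeriv_sub {c : ℝ} (hc : 0 ≤ c) (n : ℕ) :
    AntitoneOn (fun x => invDeriv n x - invDeriv n (x + c)) (Ioi 0) := by
  have h := completelyMonotoneOn_comp_add_of_hasDerivAt 0
    (fun m x => invDeriv (n + m) x - invDeriv (n + m) (x + c))
    (fun m u hu => hasDerivAt_invDeriv_sub hc (n + m) hu)
    (fun m u hu => invDeriv_sub_nonneg hc (n + m) hu)
  simpa using h.antitoneOn_Ioi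

theorem hasSum_invDeriv_sub_add_one (n : ℕ) {u : ℝ} (hu : 0 < u) :
    HasSum (fun k : ℕ => invDeriv n (u + k) - invDeriv n (u + k + 1)) (invDeriv n u) := by
  rw [hasSum_iff_tendsto_nat_of_nonneg
    fun k => invDeriv_sub_nonneg zero_le_one n (by positivity)]
  have h : ∀ N : ℕ, ∑ k ∈ Finset.range N, (invDeriv n (u + k) - invDeriv n (u + k + 1))
      = invDeriv n u - invDeriv n (u + N) := by
    intro N
    have := Finset.sum_range_sub' (fun k : ℕ => invDeriv n (u + k)) N
    simpa [add_assoc] using this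
  simp_rw [h]
  simpa using ((tendsto_invDeriv n).comp
    (tendsto_atTop_add_const_left _ u tendsto_natCast_atTop_atTop)).const_sub (invDeriv n u)

theorem summable_polygammaDiff {c : ℝ} (h0 : 0 ≤ c) (h1 : c ≤ 1) (n : ℕ) {u : ℝ}
    (hu : 0 < u) :
    Summable fun k : ℕ => invDeriv n (u + k) - invDeriv n (u + k + c) :=
  (hasSum_invDeriv_sub_add_one n hu).summable.of_nonneg_of_le
    (fun k => invDeriv_sub_nonneg h0 n (by positivity))
    fun k => sub_le_sub_left (invDeriv_le_invDeriv n (by positivity) (by linarith)) _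

theorem polygammaDiff_nonneg {c : ℝ} (h0 : 0 ≤ c) (n : ℕ) {u : ℝ} (hu : 0 < u) :
    0 ≤ polygammaDiff c n u :=
  tsum_nonneg fun k => invDeriv_sub_nonneg h0 n (by positivity)

theorem polygammaDiff_le {c : ℝ} (h0 : 0 ≤ c) (h1 : c ≤ 1) (n : ℕ) {u : ℝ} (hu : 0 < u) :
    polygammaDiff c n u ≤ invDeriv n u := by
  rw [← (hasSum_invDeriv_sub_add_one n hu).tsum_eq]
  exact (summable_polygammaDiff h0 h1 n hu).tsum_le_tsum
    (fun k => sub_le_sub_left (invDeriv_le_invDeriv n (by positivity) (by linarith)) _)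
    (hasSum_invDeriv_sub_add_one n hu).summable

theorem polygammaDiff_sub_add_one {c : ℝ} (h0 : 0 ≤ c) (h1 : c ≤ 1) (n : ℕ) {u : ℝ}
    (hu : 0 < u) :
    polygammaDiff c n u - polygammaDiff c n (u + 1) = invDeriv n u - invDeriv n (u + c) := by
  have h := (summable_polygammaDiff h0 h1 n hu).tsum_eq_zero_add
  rw [polygammaDiff, h, polygammaDiff]
  simp [add_assoc, add_comm (1 : ℝ)]

theorem hasDerivAt_polygammaDiff {c : ℝ} (h0 : 0 ≤ c) (h1 : c ≤ 1) (n : ℕ) {u : ℝ}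
    (hu : 0 < u) :
    HasDerivAt (polygammaDiff c n) (-polygammaDiff c (n + 1) u) u := by
  have hu2 : 0 < u / 2 := by positivity
  have h := hasDerivAt_tsum_of_isPreconnected (t := Ioi (u / 2)) (y := u) (y₀ := u)
    (g := fun (k : ℕ) y => invDeriv n (y + k) - invDeriv n (y + k + c))
    (g' := fun (k : ℕ) y => -(invDeriv (n + 1) (y + k) - invDeriv (n + 1) (y + k + c)))
    (summable_polygammaDiff h0 h1 (n + 1) hu2) isOpen_Ioi isPreconnected_Ioi
    (fun k y hy => ?_) (fun k y hy => ?_) (mem_Ioi.2 (by linarith))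
    (summable_polygammaDiff h0 h1 n hu) (mem_Ioi.2 (by linarith))
  · exact h.congr_deriv tsum_neg
  · have hy0 : 0 < y := hu2.trans hy
    exact (hasDerivAt_invDeriv_sub h0 n (by positivity : 0 < y + k)).comp_add_const y k
  · have hy0 : 0 < y := hu2.trans hy
    rw [norm_neg, Real.norm_of_nonneg (invDeriv_sub_nonneg h0 _ (by positivity))]
    exact antitoneOn_invDeriv_sub h0 (n + 1) (mem_Ioi.2 (by positivity)) (mem_Ioi.2 (by positivity))
      (by rw [mem_Ioi] at hy; linarith)

theorem tendsto_polygammaDiff {c : ℝ} (h0 : 0 ≤ c) (h1 : c ≤ 1) (n : ℕ) :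
    Tendsto (polygammaDiff c n) atTop (𝓝 0) := by
  refine tendsto_of_tendsto_of_tendsto_of_le_of_le' tendsto_const_nhds (tendsto_invDeriv n) ?_ ?_
  · filter_upwards [eventually_gt_atTop 0] with u hu using polygammaDiff_nonneg h0 n hu
  · filter_upwards [eventually_gt_atTop 0] with u hu using polygammaDiff_le h0 h1 n hu

theorem tendsto_mul_polygammaDiff_succ {c : ℝ} (h0 : 0 ≤ c) (h1 : c ≤ 1) (n : ℕ) :
    Tendsto (fun u => u * polygammaDiff c (n + 1) u) atTop (𝓝 0) := by
  have h : Tendsto (fun u => (n + 1) * invDeriv n u) atTop (𝓝 0) := by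
    simpa using (tendsto_invDeriv n).const_mul ((n : ℝ) + 1)
  refine tendsto_of_tendsto_of_tendsto_of_le_of_le' tendsto_const_nhds h ?_ ?_
  · filter_upwards [eventually_gt_atTop 0] with u hu
    exact mul_nonneg hu.le (polygammaDiff_nonneg h0 _ hu)
  · filter_upwards [eventually_gt_atTop 0] with u hu
    rw [← mul_invDeriv_succ n hu]
    exact mul_le_mul_of_nonneg_left (polygammaDiff_le h0 h1 _ hu) hu.le

/-- Both sides have the same step-one difference and vanish at infinity. -/
theorem polygammaDiff_zero_eq {c : ℝ} (h0 : 0 ≤ c) (h1 : c ≤ 1) {u : ℝ} (hu : 0 < u) :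
    polygammaDiff c 0 u = realDigamma (u + c) - realDigamma u := by
  have hstep : ∀ v > 0, polygammaDiff c 0 (v + 1) - (realDigamma (v + 1 + c) - realDigamma (v + 1))
      = polygammaDiff c 0 v - (realDigamma (v + c) - realDigamma v) := by
    intro v hv
    have hvc : 0 < v + c := by positivity
    have e := polygammaDiff_sub_add_one h0 h1 0 hv
    simp only [invDeriv, Nat.factorial_zero, Nat.cast_one, zero_add, pow_one] at e
    rw [add_right_comm, realDigamma_add_one hv, realDigamma_add_one hvc]
    linarith
  have hlim : Tendsto (fun v => polygammaDiff c 0 v - (realDigamma (v + c) - realDigamma v)) atTop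
      (𝓝 0) := by
    simpa using (tendsto_polygammaDiff h0 h1 0).sub (tendsto_realDigamma_add_sub c)
  have hle := nonneg_of_add_one_le_of_tendsto_zero (fun v hv => (hstep v hv).le) hlim hu
  have hge := nonneg_of_add_one_le_of_tendsto_zero
    (F := fun v => -(polygammaDiff c 0 v - (realDigamma (v + c) - realDigamma v)))
    (fun v hv => (neg_inj.2 (hstep v hv)).le) (by simpa only [neg_zero] using hlim.neg) hu
  linarith

/-! ### The scaled difference of digamma values -/

/-- The signed derivative of order `n + 1` of `u (ψ(u + c) - ψ(u))` is nonnegative. Its second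
step-one difference is the convexity defect of `invDeriv (n + 1)` at the point
`u + 1 = c (u + c) + (1 - c) (u + 1 + c)`. -/
theorem mul_polygammaDiff_succ_sub_nonneg {c : ℝ} (h0 : 0 ≤ c) (h1 : c ≤ 1) (n : ℕ) {u : ℝ}
    (hu : 0 < u) : 0 ≤ u * polygammaDiff c (n + 1) u - (n + 1) * polygammaDiff c n u := by
  have hfirst : ∀ v > 0, 0 ≤ c * invDeriv (n + 1) (v + c) - polygammaDiff c (n + 1) (v + 1) := by
    intro v hv
    refine nonneg_of_add_one_le_of_tendsto_zero (m := 0)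
      (F := fun v => c * invDeriv (n + 1) (v + c) - polygammaDiff c (n + 1) (v + 1))
      (fun w hw => ?_) ?_ hv
    · have hw : 0 < w := hw
      have hconv := (convexOn_invDeriv (n + 1)).2 (mem_Ioi.2 (by positivity : 0 < w + c))
        (mem_Ioi.2 (by positivity : 0 < w + 1 + c)) h0 (sub_nonneg.2 h1) (by ring)
      simp only [smul_eq_mul] at hconv
      rw [show c * (w + c) + (1 - c) * (w + 1 + c) = w + 1 by ring] at hconv
      have e := polygammaDiff_sub_add_one h0 h1 (n + 1) (by positivity : 0 < w + 1)
      linarith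
    · have l1 := ((tendsto_invDeriv (n + 1)).comp
        (tendsto_atTop_add_const_right _ c tendsto_id)).const_mul c
      have l2 := (tendsto_polygammaDiff h0 h1 (n + 1)).comp
        (tendsto_atTop_add_const_right _ 1 tendsto_id)
      simpa using l1.sub l2
  refine nonneg_of_add_one_le_of_tendsto_zero (m := 0)
    (F := fun u => u * polygammaDiff c (n + 1) u - (n + 1) * polygammaDiff c n u)
    (fun v hv => ?_) ?_ hu
  · have hv : 0 < v := hv
    have e1 := polygammaDiff_sub_add_one h0 h1 (n + 1) hv
    have e0 := polygammaDiff_sub_add_one h0 h1 n hv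
    have m1 := mul_invDeriv_succ n hv
    have m2 := mul_invDeriv_succ n (by positivity : 0 < v + c)
    have key : v * polygammaDiff c (n + 1) v - (n + 1) * polygammaDiff c n v
        - ((v + 1) * polygammaDiff c (n + 1) (v + 1) - (n + 1) * polygammaDiff c n (v + 1))
        = c * invDeriv (n + 1) (v + c) - polygammaDiff c (n + 1) (v + 1) := by
      linear_combination v * e1 - (n + 1) * e0 + m1 - m2
    linarith [hfirst v hv]
  · have l := (tendsto_mul_polygammaDiff_succ h0 h1 n).sub
      ((tendsto_polygammaDiff h0 h1 n).const_mul ((n : ℝ) + 1))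
    simpa using l

theorem completelyMonotoneOn_mul_realDigamma_sub (a : ℝ) {c β : ℝ} (h0 : 0 < c) (h1 : c < 1)
    (hβ : β ≤ c) :
    CompletelyMonotoneOn
      (fun x => (x + a) * (realDigamma (x + a + c) - realDigamma (x + a)) - β) (Ioi (-a)) := by
  let F : ℕ → ℝ → ℝ := fun n u => match n with
    | 0 => u * polygammaDiff c 0 u - β
    | n + 1 => u * polygammaDiff c (n + 1) u - (n + 1) * polygammaDiff c n u
  have h := completelyMonotoneOn_comp_add_of_hasDerivAt a F (fun n u hu => ?_) (fun n u hu => ?_)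
  · refine h.congr fun x hx => ?_
    rw [mem_Ioi] at hx
    simp only [F, polygammaDiff_zero_eq h0.le h1.le (by linarith : 0 < x + a)]
  · have hd (m : ℕ) := hasDerivAt_polygammaDiff h0.le h1.le m hu
    cases n with
    | zero =>
      refine (((hasDerivAt_id u).mul (hd 0)).sub_const β).congr_deriv ?_
      simp only [F, id]
      push_cast
      ring
    | succ n =>
      refine (((hasDerivAt_id u).mul (hd (n + 1))).sub
        ((hd n).const_mul ((n : ℝ) + 1))).congr_deriv ?_
      simp only [F, id]
      push_cast
      ring
  · cases n with
    | zero =>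
      have hdef := le_digammaDefect h0 h1 hu
      have hpos : 0 ≤ c * (1 - c) / (2 * (u * (u + 1))) := by
        have : 0 ≤ 1 - c := by linarith
        positivity
      have hmul := mul_nonneg hu.le (hpos.trans hdef)
      simp only [F, polygammaDiff_zero_eq h0.le h1.le hu]
      rw [digammaDefect, mul_sub, mul_div_cancel₀ _ hu.ne'] at hmul
      linarith
    | succ n => exact mul_polygammaDiff_succ_sub_nonneg h0.le h1.le n hu

/-! ### The functions `digammaDiff` -/

theorem digammaDiff_eq_rpow_mul {a b α β x : ℝ} (hx : 0 < x + a) :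
    digammaDiff a b α β x = (x + a) ^ (α - 1) *
      ((x + a) * (realDigamma (x + a + (b - a)) - realDigamma (x + a)) - β) := by
  rw [digammaDiff, Real.rpow_sub_one hx.ne', show x + a + (b - a) = x + b by ring]
  field_simp

theorem digammaDiff_eq_rpow_mul_digammaDefect {a b α β x : ℝ} (hx : 0 < x + a) :
    digammaDiff a b α β x = (x + a) ^ (α - 1) *
      ((x + a) * digammaDefect (b - a) (x + a) + (b - a - β)) := by
  rw [digammaDiff_eq_rpow_mul hx, digammaDefect]
  field_simp
  ring

/-- When `ψ(x + b) - ψ(x + a)` is the multiple `δ / (x + a)`, as it is for `b = a` and `b = a + 1`,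
the function reduces to a power. -/
theorem completelyMonotoneOn_digammaDiff_iff_of_eq_div {a b α β δ : ℝ}
    (h : ∀ x > -a, realDigamma (x + b) - realDigamma (x + a) = δ / (x + a)) :
    CompletelyMonotoneOn (digammaDiff a b α β) (Ioi (-a)) ↔ β = δ ∨ (β < δ ∧ α ≤ 1) := by
  have heq : EqOn (digammaDiff a b α β) (fun x => (δ - β) * (x + a) ^ (α - 1)) (Ioi (-a)) := by
    intro x hx
    rw [mem_Ioi] at hx
    have hx' : 0 < x + a := by linarith
    simp only [digammaDiff, h x hx, Real.rpow_sub_one hx'.ne']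
    ring
  have hiff : CompletelyMonotoneOn (digammaDiff a b α β) (Ioi (-a)) ↔
      CompletelyMonotoneOn (fun x => (δ - β) * (x + a) ^ (α - 1)) (Ioi (-a)) :=
    ⟨fun hf => hf.congr heq.symm, fun hf => hf.congr heq⟩
  rw [hiff, completelyMonotoneOn_const_mul_rpow_iff, sub_eq_zero, sub_pos, sub_nonpos, eq_comm]

theorem completelyMonotoneOn_digammaDiff {a b α β : ℝ} (hab : a < b) (hba : b < a + 1)
    (hβ : β ≤ b - a) (hα : α ≤ 1) : CompletelyMonotoneOn (digammaDiff a b α β) (Ioi (-a)) := by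
  have hpow := completelyMonotoneOn_const_mul_rpow a zero_le_one (sub_nonpos.2 hα)
  have hψ := completelyMonotoneOn_mul_realDigamma_sub a (sub_pos.2 hab) (by linarith) hβ
  refine (hpow.mul (uniqueDiffOn_Ioi _) hψ).congr fun x hx => ?_
  rw [mem_Ioi] at hx
  rw [digammaDiff_eq_rpow_mul (by linarith), Pi.mul_apply, one_mul]

theorem not_completelyMonotoneOn_digammaDiff_of_lt_or_lt {a b α : ℝ} (h : b < a ∨ a + 1 < b) :
    ¬ CompletelyMonotoneOn (digammaDiff a b α (b - a)) (Ioi (max (-a) (-b))) := by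
  intro hf
  obtain ⟨x, hx⟩ := exists_gt (max (-a) (-b))
  obtain ⟨hxa, hxb⟩ := max_lt_iff.1 hx
  have hxa' : 0 < x + a := by linarith
  have hc : (b - a) * (1 - (b - a)) < 0 := by
    rcases h with h | h
    · exact mul_neg_of_neg_of_pos (by linarith) (by linarith)
    · exact mul_neg_of_pos_of_neg (by linarith) (by linarith)
  have hneg := digammaDefect_neg hc hxa' (by linarith)
  have hnonneg := hf.nonneg (mem_Ioi.2 hx)
  rw [digammaDiff_eq_rpow_mul_digammaDefect hxa', sub_self, add_zero] at hnonneg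
  exact hnonneg.not_gt (mul_neg_of_pos_of_neg (Real.rpow_pos_of_pos hxa' _)
    (mul_neg_of_pos_of_neg hxa' hneg))

/-- The bracket `x + a` times the defect tends to zero, so it cannot make up for `b - a - β < 0`. -/
theorem not_completelyMonotoneOn_digammaDiff_of_sub_lt {a b α β : ℝ} (hab : a < b)
    (hba : b < a + 1) (hβ : b - a < β) :
    ¬ CompletelyMonotoneOn (digammaDiff a b α β) (Ioi (-a)) := by
  intro hf
  have hc0 : 0 < b - a := sub_pos.2 hab
  have hlim : Tendsto (fun x : ℝ => (b - a) * (1 - (b - a)) / (x + b)) atTop (𝓝 0) :=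
    tendsto_const_nhds.div_atTop (tendsto_atTop_add_const_right _ b tendsto_id)
  obtain ⟨x, hxlim, hx⟩ := ((hlim.eventually_lt_const (sub_pos.2 hβ)).and
    (eventually_gt_atTop (-a))).exists
  have hxa : 0 < x + a := by linarith
  have hxb : 0 < x + b := by linarith
  have hnonneg := hf.nonneg (mem_Ioi.2 hx)
  rw [digammaDiff_eq_rpow_mul_digammaDefect hxa] at hnonneg
  have hle := mul_le_mul_of_nonneg_left (digammaDefect_le hc0 (by linarith) hxa) hxa.le
  have e : (x + a) * ((b - a) * (1 - (b - a)) / ((x + a) * (x + a + (b - a))))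
      = (b - a) * (1 - (b - a)) / (x + b) := by
    rw [show x + a + (b - a) = x + b by ring]
    field_simp
  rw [e] at hle
  exact hnonneg.not_gt (mul_neg_of_pos_of_neg (Real.rpow_pos_of_pos hxa _) (by linarith))

theorem le_one_of_completelyMonotoneOn_digammaDiff {a b α β : ℝ} (hab : a < b) (hba : b < a + 1)
    (hβ : β < b - a) (hf : CompletelyMonotoneOn (digammaDiff a b α β) (Ioi (-a))) : α ≤ 1 := by
  by_contra! hα
  refine hf.not_tendsto_atTop ?_
  have hpow : Tendsto (fun x : ℝ => (b - a - β) * (x + a) ^ (α - 1)) atTop atTop :=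
    ((tendsto_rpow_atTop (sub_pos.2 hα)).comp
      (tendsto_atTop_add_const_right _ a tendsto_id)).const_mul_atTop (sub_pos.2 hβ)
  refine tendsto_atTop_mono' _ ?_ hpow
  filter_upwards [eventually_gt_atTop (-a)] with x hx
  have hxa : 0 < x + a := by linarith
  have hc0 : 0 < b - a := sub_pos.2 hab
  have hc1 : 0 < 1 - (b - a) := by linarith
  have hdef : 0 ≤ digammaDefect (b - a) (x + a) :=
    le_trans (by positivity) (le_digammaDefect hc0 (by linarith) hxa)
  rw [digammaDiff_eq_rpow_mul_digammaDefect hxa, mul_comm]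
  refine mul_le_mul_of_nonneg_left ?_ (Real.rpow_nonneg hxa.le _)
  linarith [mul_nonneg hxa.le hdef]

/-- For `β = b - a` the function is bounded below by a multiple of `(x + a)^(α - 2)` at infinity. -/
theorem le_two_of_completelyMonotoneOn_digammaDiff {a b α : ℝ} (hab : a < b) (hba : b < a + 1)
    (hf : CompletelyMonotoneOn (digammaDiff a b α (b - a)) (Ioi (-a))) : α ≤ 2 := by
  by_contra! hα
  refine hf.not_tendsto_atTop ?_
  have hc0 : 0 < b - a := sub_pos.2 hab
  have hc1 : 0 < 1 - (b - a) := by linarith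
  have hpow : Tendsto (fun x : ℝ => (b - a) * (1 - (b - a)) / 4 * (x + a) ^ (α - 2)) atTop
      atTop :=
    ((tendsto_rpow_atTop (sub_pos.2 hα)).comp
      (tendsto_atTop_add_const_right _ a tendsto_id)).const_mul_atTop (by positivity)
  refine tendsto_atTop_mono' _ ?_ hpow
  filter_upwards [eventually_ge_atTop (1 - a)] with x hx
  have hxa1 : 1 ≤ x + a := by linarith
  have hxa : 0 < x + a := by linarith
  have hdef := le_digammaDefect hc0 (by linarith) hxa
  rw [digammaDiff_eq_rpow_mul_digammaDefect hxa, sub_self, add_zero,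
    show α - 2 = α - 1 - 1 by ring, Real.rpow_sub_one hxa.ne' (α - 1)]
  -- `x + a + 1 ≤ 2 (x + a)` turns the factor `2` of the lower bound into `4`.
  have hle : (b - a) * (1 - (b - a)) / (4 * (x + a)) ≤ (x + a) * digammaDefect (b - a) (x + a) := by
    refine le_trans ?_ (mul_le_mul_of_nonneg_left hdef hxa.le)
    have e : (x + a) * ((b - a) * (1 - (b - a)) / (2 * ((x + a) * (x + a + 1))))
        = (b - a) * (1 - (b - a)) / (2 * (x + a + 1)) := by
      field_simp
    rw [e]
    exact div_le_div_of_nonneg_left (by positivity) (by positivity) (by linarith)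
  calc (b - a) * (1 - (b - a)) / 4 * ((x + a) ^ (α - 1) / (x + a))
      = (x + a) ^ (α - 1) * ((b - a) * (1 - (b - a)) / (4 * (x + a))) := by
        field_simp
    _ ≤ _ := mul_le_mul_of_nonneg_left hle (Real.rpow_nonneg hxa.le _)

theorem mainTheorem1 (a b α β : ℝ) (ha : 0 ≤ a) (hb : 0 ≤ b) :
    -- (i)
    (b = a →
      (CompletelyMonotoneOn (digammaDiff a b α β) (Ioi (-a)) ↔ β = 0 ∨ (β < 0 ∧ α ≤ 1))) ∧
    -- (ii)
    (b = a + 1 →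
      (CompletelyMonotoneOn (digammaDiff a b α β) (Ioi (-a)) ↔ β = 1 ∨ (β < 1 ∧ α ≤ 1))) ∧
    -- (iii), sufficiency
    (0 < 1 - b + a → 1 - b + a < 1 → β ≤ b - a → α ≤ 1 →
      CompletelyMonotoneOn (digammaDiff a b α β) (Ioi (-a))) ∧
    -- (iii), the lower bound `a < b` and the upper bound `b < a + 1` are sharp
    (b < a ∨ a + 1 < b →
      ¬ CompletelyMonotoneOn (digammaDiff a b α (b - a)) (Ioi (max (-a) (-b)))) ∧
    -- (iii), the upper bound `β ≤ b - a` is sharp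
    (0 < 1 - b + a → 1 - b + a < 1 → b - a < β →
      ¬ CompletelyMonotoneOn (digammaDiff a b α β) (Ioi (-a))) ∧
    -- (iii), necessity
    (0 < 1 - b + a → 1 - b + a < 1 → β ≤ b - a →
      CompletelyMonotoneOn (digammaDiff a b α β) (Ioi (-a)) →
      (β < b - a → α ≤ 1) ∧ (β = b - a → α ≤ 2)) := by
  refine ⟨fun h => ?_, fun h => ?_, fun hba hab hβ hα => ?_,
    not_completelyMonotoneOn_digammaDiff_of_lt_or_lt, fun hba hab hβ => ?_,
    fun hba hab _ hf => ⟨fun hβ => ?_, fun hβ => ?_⟩⟩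
  · exact completelyMonotoneOn_digammaDiff_iff_of_eq_div fun x _ => by simp [h]
  · refine completelyMonotoneOn_digammaDiff_iff_of_eq_div fun x hx => ?_
    rw [h, ← add_assoc, realDigamma_add_one (by linarith), add_sub_cancel_left]
  · exact completelyMonotoneOn_digammaDiff (by linarith) (by linarith) hβ hα
  · exact not_completelyMonotoneOn_digammaDiff_of_sub_lt (by linarith) (by linarith) hβ
  · exact le_one_of_completelyMonotoneOn_digammaDiff (by linarith) (by linarith) hβ hf
  · subst hβ
    exact le_two_of_completelyMonotoneOn_digammaDiff (by linarith) (by linarith) hf
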